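/- Let $d\ge 0$ be an integer. For a $d$-polytope $P$ (the convex hull of a nonempty finite set of points in some $\mathbb{R}^n$, with affine hull of dimension $d$), let $G(P)$ be the graph formed by its vertices and edges, and call a vertex of $P$ \emph{nonsimple} if it is incident to more than $d$ edges of $P$. **Theorem.** If $P$ is a $d$-polytope with at most two nonsimple vertices, then the graph of $P$ determines the entire face lattice of $P$ among $d$-polytopes. That is, for every $d$-polytope $Q$ and every graph isomorphism $f\colon G(P)\to G(Q)$ there is an isomorphism $\Phi$ from the face lattice of $P$ to the face lattice of $Q$ (both ordered by inclusion) that extends $f$: for every face $F$ of $P$, the vertices of the face $\Phi(F)$ of $Q$ are exactly the images under $f$ of the vertices of $F$. -/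

import Mathlib

/-- `P` is a (convex) `d`-polytope in `ℝⁿ`: the convex hull of a nonempty finite set of points,
whose affine hull has dimension `d`. -/
def IsDPolytope (d : ℕ) {n : ℕ} (P : Set (EuclideanSpace ℝ (Fin n))) : Prop :=
  P.Nonempty ∧ (∃ S : Finset (EuclideanSpace ℝ (Fin n)), P = convexHull ℝ (S : Set _)) ∧
    Module.finrank ℝ (vectorSpan ℝ P) = d

/-- The faces of `P`, ordered by inclusion. A face is the empty set, or the set of points of `P` at
which some linear functional attains its maximum over `P` (the zero functional gives `P` itself). -/
abbrev FaceLattice {n : ℕ} (P : Set (EuclideanSpace ℝ (Fin n))) : Type :=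
  {F : Set (EuclideanSpace ℝ (Fin n)) // IsExposed ℝ P F}

/-- The vertices of `P`: the points `x` such that `{x}` is a face of `P`. -/
abbrev PolytopeVertex {n : ℕ} (P : Set (EuclideanSpace ℝ (Fin n))) : Type :=
  {x : EuclideanSpace ℝ (Fin n) // IsExposed ℝ P {x}}

/-- The graph `G(P)` of `P`: two distinct vertices are adjacent when the segment that joins them is
a face (an edge) of `P`. -/
def polytopeGraph {n : ℕ} (P : Set (EuclideanSpace ℝ (Fin n))) :
    SimpleGraph (PolytopeVertex P) where
  Adj x y := x ≠ y ∧ IsExposed ℝ P (segment ℝ x.1 y.1)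
  symm := ⟨fun x y h => ⟨h.1.symm, by rw [segment_symm]; exact h.2⟩⟩
  loopless := ⟨fun _ h => h.1 rfl⟩

/-- The nonsimple vertices of a `d`-polytope `P`: those incident to more than `d` edges. -/
def nonsimpleVertices (d : ℕ) {n : ℕ} (P : Set (EuclideanSpace ℝ (Fin n))) :
    Set (PolytopeVertex P) :=
  {v | (d : ℕ∞) < ((polytopeGraph P).neighborSet v).encard}

/-!
The proof compares the two families of vertex sets of faces, carried to the same vertex set `V` by
`f`, and shows that they are equal.

*Geometry.* A polytope enters only through the space `L` of restrictions of affine functions to its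
vertices (`affineFunctions`): the vertex sets of faces are the zero sets of nonnegative members of
`L`. Minimising ratios of such functions shows that a face lies in the cone spanned at any of its
vertices by its edges there (`IsPolytopal.nonneg_of_adj`). At a simple vertex a dimension count then
makes the faces correspond to the sets of edges (`IsPolytopal.exists_face`), and the degree of a
simple vertex in a face depends only on the face. `FaceSystem` collects the combinatorial
consequences.

*Counting.* Let all vertices except `u` and `v` be simple. Following Kalai, for a vertex order with
`v` last count the pairs of a face and a local maximum on it, leaving out `v`. Each nonempty face
that avoids `v` contributes at least one pair, and equality holds exactly when the order is good:
all these local maxima are maxima of faces that avoid `v`. A simple vertex with `i` lower neighbours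
contributes `2 ^ i` pairs in either polytope. If `u` comes first it contributes only the face `{u}`,
so the good orders with `u` first and `v` last are the same for both polytopes, and those that have
a given face as initial segment identify the faces that contain `u` but not `v`. With these known,
the contribution of `u` is known for every order, and all faces that avoid `v`, and by symmetry all
that avoid `u`, are identified (`FaceSystem.mem_of_not_and`). The orders come from linear objective
functions after a projective transformation that sends `v` to infinity
(`IsPolytopal.exists_order`).

*Faces that contain `u` and `v`.* At a simple vertex `x` of such a face `F`, let `F'` be the face of
the other polytope with the same edges at `x`. Through an edge with simple ends, at most one
two-dimensional face contains both `u` and `v`, and the others are known; this forces `F` and `F'`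
to have the same edges at neighbouring simple vertices as well (`FaceSystem.inter_eq_of_adj`). When
`u` and `v` are adjacent or `F` has dimension at least three, `F` stays connected without `u` and
`v`, as in Balinski's theorem, so `F = F'`. In the remaining case `F` is the only two-dimensional
face that contains `u` and `v` (`FaceSystem.eq_of_not_adj`).
-/

/-! ### Faces of a space of functions on a vertex set -/

section VertexFunctions

variable {V : Type*}

/-- The faces cut out by a linear space `L` of functions on `V`: the zero sets of the nonnegative
members of `L`. When `L` consists of the restrictions of the affine functions to the vertices of a
polytope, these are the vertex sets of its faces. -/
def IsFace (L : Submodule ℝ (V → ℝ)) (F : Set V) : Prop :=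
  ∃ l ∈ L, (∀ v, 0 ≤ l v) ∧ ∀ v, l v = 0 ↔ v ∈ F

/-- The properties of the space `L` of affine functions on the vertex set of a polytope with
graph `G` and dimension at least `d` that the argument needs: `L` contains a positive function (for
a polytope, a constant), each vertex is a face, and the edges of `G` are the faces with two
vertices. -/
structure IsPolytopal (d : ℕ) (G : SimpleGraph V) (L : Submodule ℝ (V → ℝ)) : Prop where
  pos : IsFace L ∅
  vertex : ∀ v, IsFace L {v}
  adj : ∀ x y, G.Adj x y ↔ x ≠ y ∧ IsFace L {x, y}
  rank : d + 1 ≤ Module.finrank ℝ L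

variable {d : ℕ} {G : SimpleGraph V} {L : Submodule ℝ (V → ℝ)} {F F' : Set V}

lemma isFace_univ : IsFace L Set.univ := ⟨0, L.zero_mem, by simp, by simp⟩

lemma IsFace.inter (hF : IsFace L F) (hF' : IsFace L F') : IsFace L (F ∩ F') := by
  obtain ⟨l, hl, h0, h1⟩ := hF
  obtain ⟨m, hm, k0, k1⟩ := hF'
  refine ⟨l + m, L.add_mem hl hm, fun v => add_nonneg (h0 v) (k0 v), fun v => ?_⟩
  rw [Pi.add_apply, add_eq_zero_iff_of_nonneg (h0 v) (k0 v), h1, k1, Set.mem_inter_iff]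

/-- Restriction of the functions in `L` to a set of vertices. -/
def restrictTo (L : Submodule ℝ (V → ℝ)) (S : Set V) : L →ₗ[ℝ] (S → ℝ) :=
  (LinearMap.funLeft ℝ ℝ (Subtype.val : S → V)).comp L.subtype

lemma mem_ker_restrictTo {S : Set V} {l : L} :
    l ∈ LinearMap.ker (restrictTo L S) ↔ ∀ x ∈ S, l.1 x = 0 := by
  rw [LinearMap.mem_ker, funext_iff]
  exact ⟨fun h x hx => h ⟨x, hx⟩, fun h x => h x.1 x.2⟩

variable [Finite V]

/-- A face of a face is a face. -/
lemma IsFace.of_relative (hF : IsFace L F) {l : V → ℝ} (hl : l ∈ L) (h0 : ∀ v ∈ F, 0 ≤ l v) :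
    IsFace L {v | v ∈ F ∧ l v = 0} := by
  obtain ⟨m, hm, m0, m1⟩ := hF
  obtain ⟨C, hC⟩ := (Set.finite_range fun v => -l v / m v).bddAbove
  have key : ∀ v, v ∉ F → 0 < (C + 1) * m v + l v := fun v hv => by
    have h : 0 < m v := lt_of_le_of_ne (m0 v) fun h => hv ((m1 v).1 h.symm)
    have := hC ⟨v, rfl⟩
    rw [div_le_iff₀ h] at this
    linarith
  refine ⟨(C + 1) • m + l, L.add_mem (L.smul_mem _ hm) hl, fun v => ?_, fun v => ?_⟩
  · by_cases hv : v ∈ F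
    · simpa [(m1 v).2 hv] using h0 v hv
    · exact (key v hv).le
  · by_cases hv : v ∈ F
    · simp [(m1 v).2 hv, hv]
    · simpa [hv] using (key v hv).ne'

/-- If `l` vanishes at the vertex `w` of `F` and is negative somewhere on `F`, then the points of
`F` that minimise the ratio of `l` to a function exposing `w` form, with `w`, a face. -/
lemma IsFace.exists_ratio_face {w y : V} (hw : IsFace L {w}) (hF : IsFace L F) (hwF : w ∈ F)
    {l : V → ℝ} (hl : l ∈ L) (hlw : l w = 0) (hy : y ∈ F) (hly : l y < 0) :
    ∃ F₂, IsFace L F₂ ∧ F₂ ⊆ F ∧ w ∈ F₂ ∧ (∃ z ∈ F₂, z ≠ w) ∧ ∀ z ∈ F₂, z ≠ w → l z < 0 := by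
  obtain ⟨m, hm, m0, m1⟩ := hw
  have mpos : ∀ v, v ≠ w → 0 < m v := fun v hv =>
    lt_of_le_of_ne (m0 v) fun h => hv ((m1 v).1 h.symm)
  have hyw : y ≠ w := by rintro rfl; exact hly.ne hlw
  obtain ⟨z, ⟨hzF, hzw⟩, hz⟩ := Set.exists_min_image {v | v ∈ F ∧ v ≠ w} (fun v => l v / m v)
    (Set.toFinite _) ⟨y, hy, hyw⟩
  set q := l z / m z with hq
  have hmw : m w = 0 := (m1 w).2 rfl
  have hq0 : q < 0 := (hz y ⟨hy, hyw⟩).trans_lt (div_neg_of_neg_of_pos hly (mpos y hyw))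
  have hlz : l z = q * m z := by rw [hq, div_mul_cancel₀ _ (mpos z hzw).ne']
  refine ⟨{v | v ∈ F ∧ (l - q • m) v = 0}, hF.of_relative (L.sub_mem hl (L.smul_mem _ hm)) ?_,
    fun v hv => hv.1, ⟨hwF, by simp [hlw, hmw]⟩, ⟨z, ⟨hzF, by simp [hlz]⟩, hzw⟩, ?_⟩
  · intro v hv
    by_cases h : v = w
    · simp [h, hlw, hmw]
    · have := hz v ⟨hv, h⟩
      rw [le_div_iff₀ (mpos v h)] at this
      simpa using this
  · rintro v ⟨hv, h⟩ hvw
    have h2 : l v = q * m v := by simpa [sub_eq_zero] using h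
    rw [h2]
    exact mul_neg_of_neg_of_pos hq0 (mpos v hvw)

/-- A vertex `w` of a face `F ≠ {w}` has a neighbour in `F`: a minimal face that properly contains
`w` has exactly two vertices. -/
lemma IsPolytopal.exists_adj (hL : IsPolytopal d G L) (hF : IsFace L F) {w y : V} (hw : w ∈ F)
    (hy : y ∈ F) (hyw : y ≠ w) : ∃ z ∈ F, G.Adj w z := by
  obtain ⟨M, ⟨⟨hM, hMF, hwM, y, hyM, hyw⟩, hmin⟩⟩ := exists_minimal_of_wellFoundedLT
    (fun M : Set V => IsFace L M ∧ M ⊆ F ∧ w ∈ M ∧ ∃ y ∈ M, y ≠ w)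
    ⟨F, hF, subset_rfl, hw, y, hy, hyw⟩
  refine ⟨y, hMF hyM, (hL.adj w y).2 ⟨hyw.symm, ?_⟩⟩
  suffices h : M = {w, y} from h ▸ hM
  refine Set.Subset.antisymm (fun z hz => ?_) (by rintro _ (rfl | rfl) <;> assumption)
  by_contra hne
  simp only [Set.mem_insert_iff, Set.mem_singleton_iff, not_or] at hne
  obtain ⟨ly, hly, ly0, ly1⟩ := hL.vertex y
  obtain ⟨lz, hlz, lz0, lz1⟩ := hL.vertex z
  have lypos : ∀ v, v ≠ y → 0 < ly v := fun v hv =>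
    lt_of_le_of_ne (ly0 v) fun h => hv ((ly1 v).1 h.symm)
  have lzpos : ∀ v, v ≠ z → 0 < lz v := fun v hv =>
    lt_of_le_of_ne (lz0 v) fun h => hv ((lz1 v).1 h.symm)
  -- this function vanishes at `w`, is negative at `y` and positive at `z`
  have hl := L.sub_mem (L.smul_mem (lz w) hly) (L.smul_mem (ly w) hlz)
  have hy0 : ly y = 0 := (ly1 y).2 rfl
  have hz0 : lz z = 0 := (lz1 z).2 rfl
  have hlyz : 0 < lz y := lzpos y (Ne.symm hne.2)
  obtain ⟨F₂, hF₂, hsub, hwF₂, hne₂, hneg⟩ := (hL.vertex w).exists_ratio_face hM hwM hl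
    (by simp [mul_comm]) hyM (by simpa [hy0] using mul_pos (lypos w hyw.symm) hlyz)
  have hzF₂ : z ∈ F₂ := hmin ⟨hF₂, hsub.trans hMF, hwF₂, hne₂⟩ hsub hz
  have := hneg z hzF₂ hne.1
  simp only [Pi.sub_apply, Pi.smul_apply, smul_eq_mul, hz0, mul_zero, sub_zero] at this
  exact absurd this (mul_pos (lzpos w (Ne.symm hne.1)) (lypos z hne.2)).not_gt

/-- A face lies in the cone spanned at a vertex `w` by the edges through `w`, in dual form: a
function that vanishes at `w` and is nonnegative at the neighbours of `w` in a face is nonnegative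
on the face. -/
lemma IsPolytopal.nonneg_of_adj (hL : IsPolytopal d G L) (hF : IsFace L F) {w : V} (hw : w ∈ F)
    {l : V → ℝ} (hl : l ∈ L) (hlw : l w = 0) (h : ∀ z ∈ F, G.Adj w z → 0 ≤ l z) :
    ∀ y ∈ F, 0 ≤ l y := by
  by_contra! hcon
  obtain ⟨y, hy, hly⟩ := hcon
  obtain ⟨F₂, hF₂, hsub, hwF₂, ⟨x, hx, hxw⟩, hneg⟩ :=
    (hL.vertex w).exists_ratio_face hF hw hl hlw hy hly
  obtain ⟨z, hz, hwz⟩ := hL.exists_adj hF₂ hwF₂ hx hxw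
  exact absurd (hneg z hz hwz.ne') (h z (hsub hz) hwz).not_gt

lemma IsPolytopal.subset_of_adj (hL : IsPolytopal d G L) (hF : IsFace L F) (hF' : IsFace L F')
    {w : V} (hw : w ∈ F) (hw' : w ∈ F') (h : ∀ z ∈ F, G.Adj w z → z ∈ F') : F ⊆ F' := by
  obtain ⟨l, hl, l0, l1⟩ := hF'
  intro y hy
  have := hL.nonneg_of_adj hF hw (L.neg_mem hl) (by simp [(l1 w).2 hw'])
    (fun z hz hwz => by simp [(l1 z).2 (h z hz hwz)]) y hy
  rw [← l1]
  exact le_antisymm (by simpa using this) (l0 y)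

lemma IsPolytopal.eq_zero_of_adj (hL : IsPolytopal d G L) (hF : IsFace L F) {w : V} (hw : w ∈ F)
    {l : V → ℝ} (hl : l ∈ L) (hlw : l w = 0) (h : ∀ z ∈ F, G.Adj w z → l z = 0) :
    ∀ y ∈ F, l y = 0 := by
  intro y hy
  have h1 := hL.nonneg_of_adj hF hw hl hlw (fun z hz hwz => (h z hz hwz).ge) y hy
  have h2 := hL.nonneg_of_adj hF hw (L.neg_mem hl) (by simp [hlw])
    (fun z hz hwz => by simp [h z hz hwz]) y hy
  exact le_antisymm (by simpa using h2) h1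

/-! ### Dimension counts at simple vertices -/

/-- The closed neighbourhood of `w` within `F`. -/
abbrev starIn (G : SimpleGraph V) (F : Set V) (w : V) : Set V := insert w (F ∩ G.neighborSet w)

lemma ncard_starIn (F : Set V) (w : V) :
    (starIn G F w).ncard = (F ∩ G.neighborSet w).ncard + 1 :=
  Set.ncard_insert_of_notMem (fun h => G.loopless.irrefl w h.2) (Set.toFinite _)

lemma IsPolytopal.ker_restrictTo_eq (hL : IsPolytopal d G L) (hF : IsFace L F) {w : V}
    (hw : w ∈ F) :
    LinearMap.ker (restrictTo L F) = LinearMap.ker (restrictTo L (starIn G F w)) := by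
  ext l
  rw [mem_ker_restrictTo, mem_ker_restrictTo]
  refine ⟨fun h x hx => h x ?_, fun h => hL.eq_zero_of_adj hF hw l.2 (h w (by simp))
    fun z hz hwz => h z (Or.inr ⟨hz, hwz⟩)⟩
  rcases hx with rfl | hx
  exacts [hw, hx.1]

/-- At a simple vertex the values on the closed neighbourhood can be prescribed: they determine a
function in `L`, whose dimension exceeds the degree. -/
lemma IsPolytopal.restrictTo_star_surjective (hL : IsPolytopal d G L) {w : V}
    (hw : (G.neighborSet w).ncard ≤ d) :
    Function.Surjective (restrictTo L (starIn G Set.univ w)) := by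
  have hinj : LinearMap.ker (restrictTo L (starIn G Set.univ w)) = ⊥ := by
    rw [← hL.ker_restrictTo_eq isFace_univ (Set.mem_univ w), eq_bot_iff]
    intro l hl
    rw [mem_ker_restrictTo] at hl
    exact Subtype.ext (funext fun x => hl x trivial)
  have hinj' := LinearMap.ker_eq_bot.1 hinj
  have hcard : Module.finrank ℝ (starIn G Set.univ w → ℝ) = (G.neighborSet w).ncard + 1 := by
    have := Fintype.ofFinite (starIn G Set.univ w)
    rw [Module.finrank_pi, Fintype.card_eq_nat_card, Nat.card_coe_set_eq, ncard_starIn,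
      Set.univ_inter]
  have h1 := LinearMap.finrank_le_finrank_of_injective hinj'
  have h2 := hL.rank
  exact (LinearMap.injective_iff_surjective_of_finrank_eq_finrank (by omega)).1 hinj'

lemma IsPolytopal.exists_prescribed (hL : IsPolytopal d G L) {w : V}
    (hw : (G.neighborSet w).ncard ≤ d) (c : V → ℝ) :
    ∃ l ∈ L, l w = c w ∧ ∀ z, G.Adj w z → l z = c z := by
  obtain ⟨l, hl⟩ := hL.restrictTo_star_surjective hw (fun x => c x.1)
  refine ⟨l.1, l.2, ?_, fun z hz => ?_⟩
  · exact congrFun hl ⟨w, by simp⟩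
  · exact congrFun hl ⟨z, Or.inr ⟨trivial, hz⟩⟩

/-- The rank of a face that contains a simple vertex is one more than the degree of the vertex in
the face. -/
lemma IsPolytopal.finrank_ker_add (hL : IsPolytopal d G L) (hF : IsFace L F) {w : V}
    (hwF : w ∈ F) (hw : (G.neighborSet w).ncard ≤ d) :
    (F ∩ G.neighborSet w).ncard + 1 + Module.finrank ℝ (LinearMap.ker (restrictTo L F)) =
      Module.finrank ℝ L := by
  have hsurj : Function.Surjective (restrictTo L (starIn G F w)) := by
    classical
    intro c
    obtain ⟨l, hl, h1, h2⟩ := hL.exists_prescribed hw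
      (fun x => if h : x ∈ starIn G F w then c ⟨x, h⟩ else 0)
    refine ⟨⟨l, hl⟩, funext fun ⟨x, hx⟩ => ?_⟩
    have : l x = if h : x ∈ starIn G F w then c ⟨x, h⟩ else 0 := by
      rcases id hx with rfl | hx
      exacts [h1, h2 _ hx.2]
    rw [dif_pos hx] at this
    exact this
  have := LinearMap.finrank_range_add_finrank_ker (restrictTo L (starIn G F w))
  have hf := Fintype.ofFinite (starIn G F w)
  rw [LinearMap.range_eq_top.2 hsurj, finrank_top, Module.finrank_pi, Fintype.card_eq_nat_card,
    Nat.card_coe_set_eq, ncard_starIn, ← hL.ker_restrictTo_eq hF hwF] at this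
  exact this

lemma IsPolytopal.ncard_inter_eq (hL : IsPolytopal d G L) (hF : IsFace L F) {x y : V}
    (hx : x ∈ F) (hy : y ∈ F) (hxs : (G.neighborSet x).ncard ≤ d)
    (hys : (G.neighborSet y).ncard ≤ d) :
    (F ∩ G.neighborSet x).ncard = (F ∩ G.neighborSet y).ncard := by
  have h1 := hL.finrank_ker_add hF hx hxs
  have h2 := hL.finrank_ker_add hF hy hys
  omega

/-- Every set of edges through a simple vertex spans a face. -/
lemma IsPolytopal.exists_face (hL : IsPolytopal d G L) {w : V}
    (hw : (G.neighborSet w).ncard ≤ d) {S : Set V} (hS : S ⊆ G.neighborSet w) :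
    ∃ F, IsFace L F ∧ w ∈ F ∧ F ∩ G.neighborSet w = S := by
  classical
  obtain ⟨l, hl, h1, h2⟩ := hL.exists_prescribed hw
    (fun x => if x ∈ insert w S then (0 : ℝ) else 1)
  have hlw : l w = 0 := by simpa using h1
  have hz : ∀ z, G.Adj w z → l z = if z ∈ S then 0 else 1 := fun z hz => by
    rw [h2 z hz]; simp [hz.ne']
  refine ⟨{v | l v = 0}, ⟨l, hl, fun v => ?_, fun v => Iff.rfl⟩, hlw, ?_⟩
  · refine hL.nonneg_of_adj isFace_univ (Set.mem_univ w) hl hlw (fun z _ hwz => ?_) v trivial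
    rw [hz z hwz]
    split_ifs <;> norm_num
  · ext z
    simp only [Set.mem_inter_iff, Set.mem_ofPred_eq, SimpleGraph.mem_neighborSet]
    constructor
    · rintro ⟨h, hwz⟩
      by_contra hzS
      rw [hz z hwz, if_neg hzS] at h
      exact one_ne_zero h
    · exact fun h => ⟨by rw [hz z (hS h), if_pos h], hS h⟩

end VertexFunctions

section GoodOrders

open Filter Topology

variable {V : Type*} {d : ℕ} {G : SimpleGraph V} {L : Submodule ℝ (V → ℝ)} {F F' : Set V}

/-! ### Generic vertex orders -/

/-- A small perturbation of a function on a finite set keeps all strict inequalities. -/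
lemma eventually_lt_perturb [Finite V] (α β : V → ℝ) :
    ∀ᶠ ε in 𝓝[>] (0 : ℝ), ∀ x y, α x < α y → α x + ε * β x < α y + ε * β y := by
  rw [eventually_all]
  intro x
  rw [eventually_all]
  intro y
  by_cases h : α x < α y
  · have hc : Tendsto (fun ε : ℝ => (α y + ε * β y) - (α x + ε * β x)) (𝓝[>] 0)
        (𝓝 ((α y + 0 * β y) - (α x + 0 * β x))) :=
      (Continuous.tendsto (by fun_prop) 0).mono_left nhdsWithin_le_nhds
    filter_upwards [hc.eventually (lt_mem_nhds (show (0 : ℝ) < _ by linarith))] with ε hε _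
    linarith
  · exact Eventually.of_forall fun ε h' => absurd h' h

/-- Some function in `L` has pairwise distinct ratios to a given `h` on the set where `h > 0`. -/
lemma IsPolytopal.exists_generic [Finite V] (hL : IsPolytopal d G L) (h : V → ℝ) :
    ∃ ψ ∈ L, ∀ x y, 0 < h x → x ≠ y → ψ x * h y ≠ ψ y * h x := by
  classical
  have := Fintype.ofFinite V
  let S : V × V → Submodule ℝ L := fun p =>
    LinearMap.ker (((h p.2) • LinearMap.proj p.1 - (h p.1) • LinearMap.proj p.2 :
      (V → ℝ) →ₗ[ℝ] ℝ).comp L.subtype)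
  have hS : ∀ p : V × V, ∀ l : L, l ∈ S p ↔ h p.2 * l.1 p.1 - h p.1 * l.1 p.2 = 0 :=
    fun p l => by simp [S]
  let I : Finset (V × V) := Finset.univ.filter fun p => 0 < h p.1 ∧ p.1 ≠ p.2
  have htop : ⊤ ∉ I.image S := by
    intro hmem
    obtain ⟨p, hp, hp'⟩ := Finset.mem_image.1 hmem
    simp only [I, Finset.mem_filter, Finset.mem_univ, true_and] at hp
    obtain ⟨l, hl, l0, l1⟩ := hL.vertex p.1
    have : (⟨l, hl⟩ : L) ∈ S p := hp' ▸ Submodule.mem_top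
    rw [hS] at this
    dsimp only at this
    have hl1 : l p.1 = 0 := (l1 _).2 rfl
    rw [hl1, mul_zero, zero_sub, neg_eq_zero, mul_eq_zero] at this
    rcases this with h' | h'
    · exact hp.1.ne' h'
    · exact hp.2 ((l1 _).1 h').symm
  have hne := Subspace.biUnion_ne_univ_of_top_notMem htop
  obtain ⟨ψ, hψ⟩ := (Set.ne_univ_iff_exists_notMem _).1 hne
  refine ⟨ψ.1, ψ.2, fun x y hx hxy heq => hψ ?_⟩
  simp only [Set.mem_iUnion]
  refine ⟨S (x, y), Finset.mem_image.2 ⟨(x, y), by simp [I, hx, hxy], rfl⟩, ?_⟩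
  rw [SetLike.mem_coe, hS]
  linarith [mul_comm (h x) (ψ.1 y), mul_comm (h y) (ψ.1 x)]

/-- For a face `F` that avoids `b` there is a vertex order with `b` last, `F` an initial segment
and, if `a ∈ F`, the vertex `a` first, in which no face has a local maximum other than its maximum.
The order is given by a ratio `g / h` with `h` exposing `b` and `g` a perturbation of a function
exposing `F`; this is a linear objective function after a projective transformation that sends
`b` to infinity. -/
lemma IsPolytopal.exists_order [Finite V] (hL : IsPolytopal d G L) (hF : IsFace L F) (a : V)
    {b : V} (hb : b ∉ F) :
    ∃ r : V → ℝ, Function.Injective r ∧ (∀ x, x ≠ b → r x < r b) ∧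
      (∀ x ∈ F, ∀ y ∉ F, r x < r y) ∧ (a ∈ F → ∀ x, x ≠ a → r a < r x) ∧
      ∀ F', IsFace L F' → ∀ x ∈ F', ∀ y ∈ F', r x < r y → ∃ z ∈ F', G.Adj x z ∧ r x < r z := by
  classical
  obtain ⟨h, hh, h0, h1⟩ := hL.vertex b
  obtain ⟨la, hla, la0, la1⟩ := hL.vertex a
  obtain ⟨lF, hlF, lF0, lF1⟩ := hF
  obtain ⟨ψ, hψ, hψ'⟩ := hL.exists_generic h
  have hpos : ∀ x, x ≠ b → 0 < h x := fun x hx =>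
    lt_of_le_of_ne (h0 x) fun h => hx ((h1 x).1 h.symm)
  have hhb : h b = 0 := (h1 b).2 rfl
  -- an injective ratio that is least at `a`
  obtain ⟨δ, hδ, hδ0⟩ := ((eventually_lt_perturb (fun x => la x / h x)
    (fun x => ψ x / h x)).and self_mem_nhdsWithin).exists
  set β : V → ℝ := fun x => la x / h x + δ * (ψ x / h x) with hβ
  have hβinj : ∀ x y, x ≠ b → y ≠ b → β x = β y → x = y := by
    intro x y hx hy hxy
    by_contra hne
    rcases lt_trichotomy (la x / h x) (la y / h y) with hlt | heq | hlt
    · exact (hδ x y hlt).ne hxy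
    · have : δ * (ψ x / h x) = δ * (ψ y / h y) := by
        simp only [hβ] at hxy; linarith
      have := mul_left_cancel₀ (ne_of_gt hδ0) this
      rw [div_eq_div_iff (hpos x hx).ne' (hpos y hy).ne'] at this
      exact hψ' x y (hpos x hx) hne this
    · exact (hδ y x hlt).ne hxy.symm
  have hβa : ∀ x, a ≠ b → x ≠ b → x ≠ a → β a < β x := by
    intro x hab hxb hxa
    apply hδ
    rw [(la1 a).2 rfl, zero_div]
    exact div_pos (lt_of_le_of_ne (la0 x) fun h => hxa ((la1 x).1 h.symm)) (hpos x hxb)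
  have hlFb : 0 < lF b := lt_of_le_of_ne (lF0 b) fun h => hb ((lF1 b).1 h.symm)
  have hcont : ∀ᶠ ε in 𝓝[>] (0 : ℝ), 0 < lF b + ε * (la b + δ * ψ b) := by
    have hc : Tendsto (fun ε : ℝ => lF b + ε * (la b + δ * ψ b)) (𝓝[>] 0)
        (𝓝 (lF b + 0 * (la b + δ * ψ b))) :=
      (Continuous.tendsto (by fun_prop) 0).mono_left nhdsWithin_le_nhds
    exact hc.eventually (lt_mem_nhds (by simpa using hlFb))
  obtain ⟨ε, ⟨hε, hεb⟩, hε0⟩ := (((eventually_lt_perturb (fun x => lF x / h x) β).and hcont).and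
    self_mem_nhdsWithin).exists
  have hε0 : 0 < ε := hε0
  set g : V → ℝ := lF + ε • (la + δ • ψ) with hg
  have hgL : g ∈ L := L.add_mem hlF (L.smul_mem _ (L.add_mem hla (L.smul_mem _ hψ)))
  have hgb : 0 < g b := by simpa only [hg, Pi.add_apply, Pi.smul_apply, smul_eq_mul] using hεb
  have hγ : ∀ x, g x / h x = lF x / h x + ε * β x := fun x => by
    simp only [hg, hβ, Pi.add_apply, Pi.smul_apply, smul_eq_mul]; ring
  obtain ⟨M, hM⟩ := (Set.finite_range fun x => g x / h x).bddAbove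
  have hM : ∀ x, g x / h x < M + 1 := fun x => (hM ⟨x, rfl⟩).trans_lt (lt_add_one M)
  set r : V → ℝ := fun x => if x = b then M + 1 else g x / h x with hr
  have hrb : r b = M + 1 := if_pos rfl
  have hrx : ∀ x, x ≠ b → r x = g x / h x := fun x hx => if_neg hx
  have hlast : ∀ x, x ≠ b → r x < r b := fun x hx => by rw [hrx x hx, hrb]; exact hM x
  have hrlt : ∀ x y, x ≠ b → y ≠ b →
      (lF x / h x < lF y / h y ∨ lF x / h x = lF y / h y ∧ β x < β y) → r x < r y := by
    intro x y hx hy hlt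
    rw [hrx x hx, hrx y hy, hγ, hγ]
    rcases hlt with hlt | ⟨heq, hlt⟩
    · exact hε x y hlt
    · rw [heq]
      linarith [mul_lt_mul_of_pos_left hlt hε0]
  have hrinj : Function.Injective r := by
    intro x y hxy
    by_contra hne
    by_cases hx : x = b
    · subst hx
      exact (hlast y (Ne.symm hne)).ne hxy.symm
    by_cases hy : y = b
    · subst hy
      exact (hlast x hne).ne hxy
    rcases lt_trichotomy (lF x / h x) (lF y / h y) with hlt | heq | hlt
    · exact (hrlt x y hx hy (Or.inl hlt)).ne hxy
    · rcases lt_trichotomy (β x) (β y) with hlt | heq' | hlt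
      · exact (hrlt x y hx hy (Or.inr ⟨heq, hlt⟩)).ne hxy
      · exact hne (hβinj x y hx hy heq')
      · exact (hrlt y x hy hx (Or.inr ⟨heq.symm, hlt⟩)).ne hxy.symm
    · exact (hrlt y x hy hx (Or.inl hlt)).ne hxy.symm
  have hinit : ∀ x ∈ F, ∀ y ∉ F, r x < r y := by
    intro x hx y hy
    have hxb : x ≠ b := by rintro rfl; exact hb hx
    by_cases hyb : y = b
    · rw [hyb]; exact hlast x hxb
    refine hrlt x y hxb hyb (Or.inl ?_)
    rw [(lF1 x).2 hx, zero_div]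
    exact div_pos (lt_of_le_of_ne (lF0 y) fun h => hy ((lF1 y).1 h.symm)) (hpos y hyb)
  refine ⟨r, hrinj, hlast, hinit, fun ha x hx => ?_, ?_⟩
  · by_cases hxF : x ∈ F
    · have hab : a ≠ b := by rintro rfl; exact hb ha
      have hxb : x ≠ b := by rintro rfl; exact hb hxF
      refine hrlt a x hab hxb (Or.inr ⟨?_, hβa x hab hxb hx⟩)
      rw [(lF1 a).2 ha, (lF1 x).2 hxF, zero_div, zero_div]
    · exact hinit a ha x hxF
  · intro F' hF' x hx y hy hxy
    by_contra! hcon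
    have hxb : x ≠ b := by
      rintro rfl
      exact lt_asymm hxy (hlast y (by rintro rfl; exact lt_irrefl _ hxy))
    -- a local maximum `x` makes `r x • h - g` nonnegative on the whole face
    have hval : ∀ z, z ≠ b → (r x • h - g) z = h z * (r x - r z) := fun z hz => by
      rw [hrx z hz, mul_sub, mul_div_cancel₀ _ (hpos z hz).ne']
      simp [mul_comm]
    have hnn := hL.nonneg_of_adj hF' hx (L.sub_mem (L.smul_mem (r x) hh) hgL)
      (by rw [hval x hxb, sub_self, mul_zero]) (fun z hz hxz => by
        have hzb : z ≠ b := by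
          rintro rfl
          exact absurd (hlast x hxb) (hcon z hz hxz).not_gt
        rw [hval z hzb]
        exact mul_nonneg (h0 z) (sub_nonneg.2 (hcon z hz hxz))) y hy
    by_cases hyb : y = b
    · subst hyb
      simp only [Pi.sub_apply, Pi.smul_apply, hhb, smul_eq_mul, mul_zero, zero_sub] at hnn
      linarith
    · rw [hval y hyb] at hnn
      exact absurd (mul_neg_of_pos_of_neg (hpos y hyb) (sub_neg.2 hxy)) hnn.not_gt

/-! ### Removing two vertices from a face -/

/-- `Linked G S x y`: the vertices `x` and `y` are equal or joined by a path of `G` inside `S`. -/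
abbrev Linked (G : SimpleGraph V) (S : Set V) : V → V → Prop :=
  Relation.ReflTransGen fun x y => x ∈ S ∧ y ∈ S ∧ G.Adj x y

lemma Linked.symm {S : Set V} {x y : V} (h : Linked G S x y) : Linked G S y x :=
  (Relation.ReflTransGen.swap _ _ h).lift id fun _ _ h => ⟨h.2.1, h.1, h.2.2.symm⟩

lemma Linked.mono {S T : Set V} (hST : S ⊆ T) {x y : V} (h : Linked G S x y) : Linked G T x y :=
  h.lift id fun _ _ h => ⟨hST h.1, hST h.2.1, h.2.2⟩

/-- The vertices of a face on the positive side of a hyperplane are linked among themselves. -/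
lemma IsPolytopal.linked_pos [Finite V] (hL : IsPolytopal d G L) (hF : IsFace L F) {l : V → ℝ}
    (hl : l ∈ L) {x y : V} (hx : x ∈ F) (hy : y ∈ F) (hlx : 0 < l x) (hly : 0 < l y) :
    Linked G {z | z ∈ F ∧ 0 < l z} x y := by
  obtain ⟨c, hc, c0, c1⟩ := hL.pos
  have cpos : ∀ v, 0 < c v := fun v => lt_of_le_of_ne (c0 v) fun h => (c1 v).1 h.symm
  obtain ⟨t, ht, htmax⟩ := Set.exists_max_image F (fun v => l v / c v) (Set.toFinite _) ⟨x, hx⟩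
  obtain ⟨lt, hlt, lt0, lt1⟩ := hL.vertex t
  obtain ⟨ε, hε, hε0⟩ := ((eventually_lt_perturb (fun v => l v / c v)
    (fun v => -lt v / c v)).and self_mem_nhdsWithin).exists
  have hε0 : 0 < ε := hε0
  -- a perturbed ratio whose only maximum on the face is `t`
  set q : V → ℝ := fun v => l v / c v + ε * (-lt v / c v) with hq
  have hqt : ∀ v ∈ F, v ≠ t → q v < q t := by
    intro v hv hvt
    have h1 := htmax v hv
    have h2 : 0 < lt v := lt_of_le_of_ne (lt0 v) fun h => hvt ((lt1 v).1 h.symm)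
    have h3 : lt t = 0 := (lt1 t).2 rfl
    have h4 : -lt v / c v < 0 := div_neg_of_neg_of_pos (neg_neg_of_pos h2) (cpos v)
    have h5 := mul_neg_of_pos_of_neg hε0 h4
    simp only [hq, h3, neg_zero, zero_div, mul_zero, add_zero]
    linarith
  have hqle : ∀ v w, q v < q w → l v / c v ≤ l w / c w := fun v w h => by
    by_contra! h'
    exact lt_asymm h (hε w v h')
  have hstep : ∀ v ∈ F, v ≠ t → ∃ z ∈ F, G.Adj v z ∧ q v < q z := by
    intro v hv hvt
    by_contra! hcon
    have hval : ∀ z, (q v • c - (l - ε • lt)) z = c z * (q v - q z) := fun z => by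
      have := (cpos z).ne'
      simp only [hq, Pi.sub_apply, Pi.smul_apply, smul_eq_mul]
      field_simp
      ring
    have := hL.nonneg_of_adj hF hv
      (L.sub_mem (L.smul_mem (q v) hc) (L.sub_mem hl (L.smul_mem ε hlt)))
      (by rw [hval, sub_self, mul_zero]) (fun z hz hvz => by
        rw [hval]; exact mul_nonneg (c0 z) (sub_nonneg.2 (hcon z hz hvz))) t ht
    rw [hval] at this
    exact absurd (mul_neg_of_pos_of_neg (cpos t) (sub_neg.2 (hqt v hv hvt))) this.not_gt
  have htop : ∀ v, v ∈ F → 0 < l v → Linked G {z | z ∈ F ∧ 0 < l z} v t := by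
    intro v
    induction v using (Finite.wellFounded_of_trans_of_irrefl
      (fun v w : V => q w < q v)).induction with
    | _ v ih =>
      intro hv hlv
      by_cases hvt : v = t
      · rw [hvt]
      obtain ⟨z, hz, hvz, hlt⟩ := hstep v hv hvt
      have hlz : 0 < l z := by
        have := (div_pos hlv (cpos v)).trans_le (hqle v z hlt)
        rwa [div_pos_iff_of_pos_right (cpos z)] at this
      exact Relation.ReflTransGen.head ⟨⟨hv, hlv⟩, ⟨hz, hlz⟩, hvz⟩ (ih z hlt hz hlz)
  exact (htop x hx hlx).trans (htop y hy hly).symm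

/-- A face stays connected when the two ends of an edge are removed. -/
lemma IsPolytopal.linked_of_adj [Finite V] (hL : IsPolytopal d G L) (hF : IsFace L F) {u v x y : V}
    (huv : G.Adj u v) (hx : x ∈ F \ {u, v}) (hy : y ∈ F \ {u, v}) :
    Linked G (F \ {u, v}) x y := by
  obtain ⟨l, hl, l0, l1⟩ := ((hL.adj u v).1 huv).2
  have hpos : ∀ z ∉ ({u, v} : Set V), 0 < l z := fun z hz =>
    lt_of_le_of_ne (l0 z) fun h => hz ((l1 z).1 h.symm)
  refine (hL.linked_pos hF hl hx.1 hy.1 (hpos x hx.2) (hpos y hy.2)).mono ?_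
  exact fun z hz => ⟨hz.1, fun h => hz.2.ne' ((l1 z).2 h)⟩

/-- A face of dimension at least three stays connected when two vertices `u`, `v` are removed.
A hyperplane through `u`, `v` and `x` splits the rest into two connected sides, and `x` is linked
to both. -/
lemma IsPolytopal.linked_of_three_le [Finite V] (hL : IsPolytopal d G L) (hF : IsFace L F)
    {u v x y : V} (hxs : (G.neighborSet x).ncard ≤ d) (h3 : 3 ≤ (F ∩ G.neighborSet x).ncard)
    (hx : x ∈ F \ {u, v}) (hy : y ∈ F \ {u, v}) : Linked G (F \ {u, v}) x y := by
  have hrank := hL.finrank_ker_add hF hx.1 hxs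
  have hrn := LinearMap.finrank_range_add_finrank_ker (restrictTo L {u, v, x})
  have hle : Module.finrank ℝ (LinearMap.range (restrictTo L {u, v, x})) ≤ 3 := by
    refine (Submodule.finrank_le _).trans ?_
    have := Fintype.ofFinite ({u, v, x} : Set V)
    rw [Module.finrank_pi, Fintype.card_eq_nat_card, Nat.card_coe_set_eq]
    exact (Set.ncard_insert_le _ _).trans (Nat.succ_le_succ (Set.ncard_insert_le _ _ |>.trans
      (by simp)))
  have hnot : ¬ LinearMap.ker (restrictTo L {u, v, x}) ≤ LinearMap.ker (restrictTo L F) :=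
    fun h => by have := Submodule.finrank_mono h; omega
  obtain ⟨⟨l, hl⟩, hlk, hlF⟩ := SetLike.not_le_iff_exists.1 hnot
  rw [mem_ker_restrictTo] at hlk hlF
  dsimp only at hlk hlF
  push Not at hlF
  obtain ⟨z, hz, hlz⟩ := hlF
  have key : ∀ l ∈ L, (∀ w ∈ ({u, v, x} : Set V), l w = 0) → (∃ z ∈ F, 0 < l z) → 0 ≤ l y →
      Linked G (F \ {u, v}) x y := by
    rintro l hl h0 ⟨z, hz, hlz⟩ hly
    have hsub : {z | z ∈ F ∧ 0 < l z} ⊆ F \ {u, v} := by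
      rintro w ⟨hw, hlw⟩
      refine ⟨hw, ?_⟩
      rintro (rfl | rfl) <;> exact hlw.ne' (h0 _ (by simp))
    -- each vertex on the hyperplane has a neighbour on the positive side
    have hstep : ∀ w ∈ F \ {u, v}, 0 ≤ l w → ∃ w' ∈ F, 0 < l w' ∧ Linked G (F \ {u, v}) w w' := by
      intro w hw hlw
      rcases hlw.eq_or_lt with h | h
      · by_contra! hcon
        have := hL.nonneg_of_adj hF hw.1 (L.neg_mem hl) (by simp [← h]) (fun t ht hwt => by
          by_contra! hneg
          have htpos : 0 < l t := by simpa using hneg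
          exact hcon t ht htpos (Relation.ReflTransGen.single ⟨hw, hsub ⟨ht, htpos⟩, hwt⟩)) z hz
        simp only [Pi.neg_apply] at this
        linarith
      · exact ⟨w, hw.1, h, Relation.ReflTransGen.refl⟩
    obtain ⟨x', hx', hlx', hxx'⟩ := hstep x hx (h0 x (by simp)).ge
    obtain ⟨y', hy', hly', hyy'⟩ := hstep y hy hly
    exact (hxx'.trans ((hL.linked_pos hF hl hx' hy' hlx' hly').mono hsub)).trans hyy'.symm
  have hneg : ∀ w ∈ ({u, v, x} : Set V), (-l) w = 0 := fun w hw => by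
    rw [Pi.neg_apply, hlk w hw, neg_zero]
  rcases lt_trichotomy (l y) 0 with hy0 | hy0 | hy0
  · exact key _ (L.neg_mem hl) hneg ⟨y, hy.1, by simpa using hy0⟩ (by simpa using hy0.le)
  · rcases lt_or_gt_of_ne hlz with h | h
    · exact key _ (L.neg_mem hl) hneg ⟨z, hz, by simpa using h⟩ (by simp [hy0])
    · exact key _ hl hlk ⟨z, hz, h⟩ hy0.ge
  · exact key _ hl hlk ⟨y, hy.1, hy0⟩ hy0.le

end GoodOrders

section FaceSystems

variable {V : Type*}

/-! ### Face systems and the count of local maxima -/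

/-- The combinatorial properties of the family `𝓕` of vertex sets of the faces of a polytope with
graph `G` in which all vertices but possibly `u` and `v` are simple. -/
structure FaceSystem (G : SimpleGraph V) (u v : V) (𝓕 : Set (Set V)) : Prop where
  empty : ∅ ∈ 𝓕
  singleton : ∀ w, {w} ∈ 𝓕
  adj : ∀ x y, G.Adj x y ↔ x ≠ y ∧ {x, y} ∈ 𝓕
  inter : ∀ F ∈ 𝓕, ∀ F' ∈ 𝓕, F ∩ F' ∈ 𝓕
  subset_of_adj : ∀ F ∈ 𝓕, ∀ F' ∈ 𝓕, ∀ w ∈ F, w ∈ F' → (∀ z ∈ F, G.Adj w z → z ∈ F') → F ⊆ F'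
  exists_face : ∀ w, w ≠ u → w ≠ v → ∀ S ⊆ G.neighborSet w,
    ∃ F ∈ 𝓕, w ∈ F ∧ F ∩ G.neighborSet w = S
  ncard_eq : ∀ F ∈ 𝓕, ∀ x ∈ F, x ≠ u → x ≠ v → ∀ y ∈ F, y ≠ u → y ≠ v →
    (F ∩ G.neighborSet x).ncard = (F ∩ G.neighborSet y).ncard
  exists_order : ∀ F ∈ 𝓕, ∀ a, ∀ b ∉ F,
    ∃ r : V → ℝ, Function.Injective r ∧ (∀ x, x ≠ b → r x < r b) ∧
      (∀ x ∈ F, ∀ y ∉ F, r x < r y) ∧ (a ∈ F → ∀ x, x ≠ a → r a < r x) ∧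
      ∀ F' ∈ 𝓕, ∀ x ∈ F', ∀ y ∈ F', r x < r y → ∃ z ∈ F', G.Adj x z ∧ r x < r z
  linked : ∀ F ∈ 𝓕, ∀ x ∈ F \ {u, v}, ∀ y ∈ F \ {u, v},
    G.Adj u v ∨ 3 ≤ (F ∩ G.neighborSet x).ncard → Linked G (F \ {u, v}) x y

variable {d : ℕ} {G : SimpleGraph V} {u v : V} {𝓕 𝓕' : Set (Set V)}

lemma IsPolytopal.faceSystem [Finite V] {L : Submodule ℝ (V → ℝ)} (hL : IsPolytopal d G L)
    (hs : ∀ w, w ≠ u → w ≠ v → (G.neighborSet w).ncard ≤ d) :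
    FaceSystem G u v {F | IsFace L F} where
  empty := hL.pos
  singleton := hL.vertex
  adj := hL.adj
  inter _ hF _ hF' := hF.inter hF'
  subset_of_adj _ hF _ hF' _ hw hw' := hL.subset_of_adj hF hF' hw hw'
  exists_face w hu hv _ hS := hL.exists_face (hs w hu hv) hS
  ncard_eq _ hF x hx hxu hxv y hy hyu hyv :=
    hL.ncard_inter_eq hF hx hy (hs x hxu hxv) (hs y hyu hyv)
  exists_order _ hF a _ hb := hL.exists_order hF a hb
  linked _ hF x hx _ hy h := h.elim (fun h => hL.linked_of_adj hF h hx hy) fun h =>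
    hL.linked_of_three_le hF
      (hs x (fun h => hx.2 (Or.inl h)) fun h => hx.2 (Or.inr h)) h hx hy

lemma FaceSystem.symm (h : FaceSystem G u v 𝓕) : FaceSystem G v u 𝓕 where
  empty := h.empty
  singleton := h.singleton
  adj := h.adj
  inter := h.inter
  subset_of_adj := h.subset_of_adj
  exists_face w hv hu := h.exists_face w hu hv
  ncard_eq F hF x hx hxv hxu y hy hyv hyu := h.ncard_eq F hF x hx hxu hxv y hy hyu hyv
  exists_order := h.exists_order
  linked F hF x hx y hy hd := by
    rw [Set.pair_comm] at hx hy ⊢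
    exact h.linked F hF x hx y hy (hd.imp_left fun h => h.symm)

lemma FaceSystem.eq_of_inter_eq (h : FaceSystem G u v 𝓕) {F F' : Set V} (hF : F ∈ 𝓕) (hF' : F' ∈ 𝓕)
    {w : V} (hw : w ∈ F) (hw' : w ∈ F')
    (heq : F ∩ G.neighborSet w = F' ∩ G.neighborSet w) : F = F' :=
  (h.subset_of_adj F hF F' hF' w hw hw' fun _ hz hwz => (heq.subset ⟨hz, hwz⟩).1).antisymm
    (h.subset_of_adj F' hF' F hF w hw' hw fun _ hz hwz => (heq.superset ⟨hz, hwz⟩).1)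

/-- The pairs of a face and a local maximum of the order `r` on it, where `v` is disregarded, and
`u` too in the faces that contain `v`. -/
def sinkPairs (G : SimpleGraph V) (u v : V) (𝓕 : Set (Set V)) (r : V → ℝ) : Set (V × Set V) :=
  {p | p.2 ∈ 𝓕 ∧ p.1 ∈ p.2 ∧ p.1 ≠ v ∧ (p.1 = u → v ∉ p.2) ∧
    ∀ z ∈ p.2, G.Adj p.1 z → r z < r p.1}

/-- The pairs of a face that avoids `v` and its maximum in the order `r`. -/
def maxPairs (v : V) (𝓕 : Set (Set V)) (r : V → ℝ) : Set (V × Set V) :=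
  {p | p.2 ∈ 𝓕 ∧ p.1 ∈ p.2 ∧ v ∉ p.2 ∧ ∀ y ∈ p.2, y ≠ p.1 → r y < r p.1}

lemma maxPairs_subset_sinkPairs (r : V → ℝ) : maxPairs v 𝓕 r ⊆ sinkPairs G u v 𝓕 r := by
  rintro ⟨w, F⟩ ⟨hF, hw, hv, hmax⟩
  exact ⟨hF, hw, fun h => hv (h ▸ hw), fun _ => hv, fun z hz hwz => hmax z hz hwz.ne'⟩

lemma sinkPairs_eq_maxPairs {r : V → ℝ} (hr : Function.Injective r)
    (hlast : ∀ x, x ≠ v → r x < r v)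
    (hgood : ∀ F' ∈ 𝓕, ∀ x ∈ F', ∀ y ∈ F', r x < r y → ∃ z ∈ F', G.Adj x z ∧ r x < r z) :
    sinkPairs G u v 𝓕 r = maxPairs v 𝓕 r := by
  refine Set.Subset.antisymm ?_ (maxPairs_subset_sinkPairs r)
  rintro ⟨w, F⟩ ⟨hF, hw, hwv, -, hsink⟩
  have hmax : ∀ y ∈ F, ¬ r w < r y := fun y hy hlt => by
    obtain ⟨z, hz, hwz, hlt'⟩ := hgood F hF w hw y hy hlt
    exact lt_asymm hlt' (hsink z hz hwz)
  exact ⟨hF, hw, fun hv => hmax v hv (hlast w hwv), fun y hy hyw =>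
    lt_of_le_of_ne (not_lt.1 (hmax y hy)) fun h => hyw (hr h)⟩

lemma FaceSystem.eq_singleton_of_isMin (h : FaceSystem G u v 𝓕) {r : V → ℝ}
    (hr : ∀ x, x ≠ u → r u < r x) {F : Set V} (hF : F ∈ 𝓕) (hu : u ∈ F)
    (hsink : ∀ z ∈ F, G.Adj u z → r z < r u) : F = {u} :=
  (h.subset_of_adj F hF {u} (h.singleton u) u hu rfl fun z hz huz =>
    absurd (hsink z hz huz) (hr z huz.ne').not_gt).antisymm (by simpa using hu)

variable [Finite V]

/-- Each nonempty face that avoids `v` has exactly one maximum. -/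
lemma ncard_maxPairs {r : V → ℝ} (hr : Function.Injective r) :
    (maxPairs v 𝓕 r).ncard = {F | F ∈ 𝓕 ∧ F.Nonempty ∧ v ∉ F}.ncard := by
  have hinj : Set.InjOn Prod.snd (maxPairs v 𝓕 r) := by
    rintro ⟨w, F⟩ ⟨-, hw, -, hmax⟩ ⟨w', F'⟩ ⟨-, hw', -, hmax'⟩ h
    obtain rfl : F = F' := h
    by_contra hne
    have hne : w ≠ w' := fun h => hne (by rw [h])
    exact lt_asymm (hmax w' hw' hne.symm) (hmax' w hw hne)
  rw [← hinj.ncard_image]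
  congr 1
  ext F
  constructor
  · rintro ⟨⟨w, F⟩, ⟨hF, hw, hv, -⟩, rfl⟩
    exact ⟨hF, ⟨w, hw⟩, hv⟩
  · rintro ⟨hF, hne, hv⟩
    obtain ⟨w, hw, hmax⟩ := Set.exists_max_image F r F.toFinite hne
    exact ⟨(w, F), ⟨hF, hw, hv, fun y hy hyw =>
      lt_of_le_of_ne (hmax y hy) fun h => hyw (hr h)⟩, rfl⟩

/-- The number of local maxima depends on the graph only, up to the contribution of `u`: the faces
with local maximum at a simple vertex `w` correspond to the sets of lower neighbours of `w`. -/
lemma FaceSystem.ncard_sinkPairs_le (h : FaceSystem G u v 𝓕) (h' : FaceSystem G u v 𝓕')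
    {r : V → ℝ} (hu : ∀ F ∈ 𝓕', u ∈ F → v ∉ F → (∀ z ∈ F, G.Adj u z → r z < r u) → F ∈ 𝓕) :
    (sinkPairs G u v 𝓕' r).ncard ≤ (sinkPairs G u v 𝓕 r).ncard := by
  have key : ∀ p : V × Set V, ∃ F₂, p ∈ sinkPairs G u v 𝓕' r →
      (p.1, F₂) ∈ sinkPairs G u v 𝓕 r ∧ F₂ ∩ G.neighborSet p.1 = p.2 ∩ G.neighborSet p.1 := by
    rintro ⟨w, F⟩
    by_cases hp : (w, F) ∈ sinkPairs G u v 𝓕' r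
    swap
    · exact ⟨F, fun h => absurd h hp⟩
    obtain ⟨hF, hw, hwv, hwu, hsink⟩ := hp
    by_cases hwu' : w = u
    · subst hwu'
      exact ⟨F, fun _ => ⟨⟨hu F hF hw (hwu rfl) hsink, hw, hwv, hwu, hsink⟩, rfl⟩⟩
    · obtain ⟨F₂, hF₂, hwF₂, hN⟩ := h.exists_face w hwu' hwv (F ∩ G.neighborSet w)
        Set.inter_subset_right
      exact ⟨F₂, fun _ => ⟨⟨hF₂, hwF₂, hwv, fun h => absurd h hwu', fun z hz hwz =>
        hsink z (hN.subset ⟨hz, hwz⟩).1 hwz⟩, hN⟩⟩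
  choose φ hφ using key
  refine Set.ncard_le_ncard_of_injOn (fun p => (p.1, φ p)) (fun p hp => (hφ p hp).1) ?_
    (Set.toFinite _)
  rintro ⟨w, F⟩ hp ⟨w', F'⟩ hq heq
  obtain ⟨rfl : w = w', heq⟩ := Prod.mk.inj heq
  have hN := (hφ _ hp).2
  rw [heq, (hφ _ hq).2] at hN
  exact congrArg (Prod.mk w) (h'.eq_of_inter_eq hp.1 hq.1 hp.2.1 hq.2.1 hN.symm)

/-! ### Faces that contain at most one of the two exceptional vertices -/

/-- An order with `u` first and `v` last that is good for `𝓕` bounds the number of faces of `𝓕'`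
that avoid `v`. By symmetry, both systems have equally many such faces. -/
lemma FaceSystem.ncard_avoiding_le (h : FaceSystem G u v 𝓕) (h' : FaceSystem G u v 𝓕')
    (huv : u ≠ v) :
    {F | F ∈ 𝓕' ∧ F.Nonempty ∧ v ∉ F}.ncard ≤ {F | F ∈ 𝓕 ∧ F.Nonempty ∧ v ∉ F}.ncard := by
  obtain ⟨r, hr, hlast, -, hfirst, hgood⟩ := h.exists_order {u} (h.singleton u) u v
    (by simpa using huv.symm)
  have hfirst := hfirst rfl
  rw [← ncard_maxPairs hr, ← ncard_maxPairs hr, ← sinkPairs_eq_maxPairs (G := G) (u := u) hr hlast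
    hgood]
  refine (Set.ncard_le_ncard (maxPairs_subset_sinkPairs r) (Set.toFinite _)).trans
    (h.ncard_sinkPairs_le h' fun F hF hu _ hsink => ?_)
  rw [h'.eq_singleton_of_isMin hfirst hF hu hsink]
  exact h.singleton u

/-- Kalai's argument. An order with `F` as an initial segment and `v` last that is good for `𝓕`
minimises the number of local maxima, so it is good for `𝓕'`; hence the face of `𝓕'` spanned by
the edges of `F` at the last vertex of `F` lies in `F`, and the two coincide since they have the
same degree at their simple vertices. The local maxima at `u` are accounted for either because `u`
comes first or because the faces that contain `u` but not `v` are known already. -/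
lemma FaceSystem.mem_of_notMem_aux (h : FaceSystem G u v 𝓕) (h' : FaceSystem G u v 𝓕')
    (huv : u ≠ v) {F : Set V} (hF : F ∈ 𝓕) (hv : v ∉ F)
    (hu : u ∈ F ∨ ∀ F' ∈ 𝓕', u ∈ F' → v ∉ F' → F' ∈ 𝓕) : F ∈ 𝓕' := by
  rcases F.eq_empty_or_nonempty with rfl | hne
  · exact h'.empty
  by_cases hFu : F = {u}
  · exact hFu ▸ h'.singleton u
  obtain ⟨r, hr, hlast, hinit, hfirst, hgood⟩ := h.exists_order F hF u v hv
  have hle := h.ncard_sinkPairs_le h' (r := r) fun F' hF' huF' hvF' hsink => by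
    rcases hu with hu | hu
    · rw [h'.eq_singleton_of_isMin (hfirst hu) hF' huF' hsink]
      exact h.singleton u
    · exact hu F' hF' huF' hvF'
  rw [sinkPairs_eq_maxPairs hr hlast hgood, ncard_maxPairs hr] at hle
  have hge := h'.ncard_avoiding_le h huv
  rw [← ncard_maxPairs (𝓕 := 𝓕') hr] at hge
  have heq : maxPairs v 𝓕' r = sinkPairs G u v 𝓕' r :=
    Set.eq_of_subset_of_ncard_le (maxPairs_subset_sinkPairs r) (hle.trans hge) (Set.toFinite _)
  obtain ⟨x, hx, hxmax⟩ := Set.exists_max_image F r F.toFinite hne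
  have hxmax : ∀ y ∈ F, y ≠ x → r y < r x := fun y hy hyx =>
    lt_of_le_of_ne (hxmax y hy) fun h => hyx (hr h)
  have hxv : x ≠ v := by rintro rfl; exact hv hx
  have hxu : x ≠ u := by
    rintro rfl
    exact hFu (Set.Subset.antisymm (fun y hy => by
      by_contra hyx
      exact lt_asymm (hxmax y hy hyx) (hfirst hx y hyx)) (by simpa using hx))
  obtain ⟨F', hF', hxF', hN⟩ := h'.exists_face x hxu hxv (F ∩ G.neighborSet x)
    Set.inter_subset_right
  have hp : (x, F') ∈ sinkPairs G u v 𝓕' r := ⟨hF', hxF', hxv, fun h => absurd h hxu,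
    fun z hz hxz => hxmax z (hN.subset ⟨hz, hxz⟩).1 hxz.ne'⟩
  rw [← heq] at hp
  obtain ⟨-, -, -, hmax'⟩ := hp
  have hsub : F' ⊆ F := fun y hy => by
    by_cases hyx : y = x
    · exact hyx ▸ hx
    by_contra hyF
    exact lt_asymm (hmax' y hy hyx) (hinit x hx y hyF)
  suffices h : F ⊆ F' from (h.antisymm hsub) ▸ hF'
  by_contra hnot
  -- the last vertex of `F` outside `F'` has a later neighbour, which lies in `F'`
  obtain ⟨t, ⟨ht, htF'⟩, htmax⟩ := Set.exists_max_image (F \ F') r (Set.toFinite _)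
    (Set.sdiff_nonempty.2 hnot)
  have htx : t ≠ x := by rintro rfl; exact htF' hxF'
  obtain ⟨z, hz, htz, hlt⟩ := hgood F hF t ht x hx (hxmax t ht htx)
  have hzF' : z ∈ F' := by
    by_contra hzF'
    exact (htmax z ⟨hz, hzF'⟩).not_gt hlt
  have hzu : z ≠ u := by
    rintro rfl
    exact lt_asymm hlt (hfirst hz t htz.ne)
  have hzv : z ≠ v := by rintro rfl; exact hv hz
  have hdeg : F' ∩ G.neighborSet z = F ∩ G.neighborSet z := by
    refine Set.eq_of_subset_of_ncard_le (Set.inter_subset_inter_left _ hsub) ?_ (Set.toFinite _)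
    rw [h.ncard_eq F hF z hz hzu hzv x hx hxu hxv, ← hN,
      h'.ncard_eq F' hF' x hxF' hxu hxv z hzF' hzu hzv]
  exact htF' (hdeg.superset ⟨ht, htz.symm⟩).1

lemma FaceSystem.mem_of_notMem (h : FaceSystem G u v 𝓕) (h' : FaceSystem G u v 𝓕')
    (huv : u ≠ v) {F : Set V} (hF : F ∈ 𝓕) (hv : v ∉ F) : F ∈ 𝓕' :=
  h.mem_of_notMem_aux h' huv hF hv <| Or.inr fun _ hF' hu' hv' =>
    h'.mem_of_notMem_aux h huv hF' hv' (Or.inl hu')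

lemma FaceSystem.mem_of_not_and (h : FaceSystem G u v 𝓕) (h' : FaceSystem G u v 𝓕')
    (huv : u ≠ v) {F : Set V} (hF : F ∈ 𝓕) (hn : ¬ (u ∈ F ∧ v ∈ F)) : F ∈ 𝓕' := by
  by_cases hv : v ∈ F
  · exact h.symm.mem_of_notMem h'.symm huv.symm hF fun hu => hn ⟨hu, hv⟩
  · exact h.mem_of_notMem h' huv hF hv

/-! ### Faces that contain both exceptional vertices -/

/-- If `F` and `F'` have the same edges at one end of an edge with simple ends, then also at the
other. The two-dimensional faces through the edge match the further edges at one end with those at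
the other, and all but at most one of these two-dimensional faces are common to both systems. -/
lemma FaceSystem.inter_eq_of_adj (h : FaceSystem G u v 𝓕) (h' : FaceSystem G u v 𝓕')
    (huv : u ≠ v) {F F' : Set V} (hF : F ∈ 𝓕) (hF' : F' ∈ 𝓕') {x y : V} (hxF : x ∈ F)
    (hxF' : x ∈ F') (hyF : y ∈ F) (hxu : x ≠ u) (hxv : x ≠ v) (hyu : y ≠ u) (hyv : y ≠ v)
    (hxy : G.Adj x y) (hN : F ∩ G.neighborSet x = F' ∩ G.neighborSet x) :
    y ∈ F' ∧ F ∩ G.neighborSet y = F' ∩ G.neighborSet y := by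
  have hyF' : y ∈ F' := (hN.subset ⟨hyF, hxy⟩).1
  refine ⟨hyF', ?_⟩
  have hcard : (F ∩ G.neighborSet y).ncard = (F' ∩ G.neighborSet y).ncard := by
    rw [h.ncard_eq F hF y hyF hyu hyv x hxF hxu hxv, hN,
      h'.ncard_eq F' hF' x hxF' hxu hxv y hyF' hyu hyv]
  have hspan : ∀ z, G.Adj y z → ∃ K ∈ 𝓕, y ∈ K ∧ K ∩ G.neighborSet y = {x, z} := fun z hz =>
    h.exists_face y hyu hyv {x, z} (by rintro _ (rfl | rfl); exacts [hxy.symm, hz])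
  by_cases hex : ∃ K ∈ 𝓕, y ∈ K ∧ K ⊆ F ∧ u ∈ K ∧ v ∈ K ∧ ∃ z, K ∩ G.neighborSet y = {x, z}
  · obtain ⟨K₀, hK₀, hyK₀, hK₀F, hu₀, hv₀, z₀, hN₀⟩ := hex
    refine (Set.eq_of_subset_of_ncard_le ?_ hcard.le (Set.toFinite _)).symm
    rintro z ⟨hzF', hyz : G.Adj y z⟩
    refine ⟨?_, hyz⟩
    by_contra hzF
    obtain ⟨K, hK, hyK, hNK⟩ := hspan z hyz
    have hxK : x ∈ K := (hNK.superset (Or.inl rfl)).1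
    have hzK : z ∈ K := (hNK.superset (Or.inr rfl)).1
    have hKn : ¬ (u ∈ K ∧ v ∈ K) := by
      rintro ⟨huK, -⟩
      have hsub := h.subset_of_adj _ (h.inter K hK K₀ hK₀) {y, x} ((h.adj y x).1 hxy.symm).2 y
        ⟨hyK, hyK₀⟩ (Or.inl rfl) (fun t ht hyt => by
          rcases hNK.subset ⟨ht.1, hyt⟩ with rfl | rfl
          · exact Or.inr rfl
          · exact absurd (hK₀F ht.2) hzF)
      rcases hsub ⟨huK, hu₀⟩ with h | h
      exacts [hyu h.symm, hxu h.symm]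
    have hK' := h.mem_of_not_and h' huv hK hKn
    have hKF' : K ⊆ F' := h'.subset_of_adj K hK' F' hF' y hyK hyF' fun t ht hyt => by
      rcases hNK.subset ⟨ht, hyt⟩ with rfl | rfl <;> assumption
    exact hzF (h.subset_of_adj K hK F hF x hxK hxF
      (fun t ht hxt => (hN.superset ⟨hKF' ht, hxt⟩).1) hzK)
  · refine Set.eq_of_subset_of_ncard_le ?_ hcard.ge (Set.toFinite _)
    rintro z ⟨hzF, hyz : G.Adj y z⟩
    refine ⟨?_, hyz⟩
    obtain ⟨K, hK, hyK, hNK⟩ := hspan z hyz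
    have hxK : x ∈ K := (hNK.superset (Or.inl rfl)).1
    have hzK : z ∈ K := (hNK.superset (Or.inr rfl)).1
    have hKF : K ⊆ F := h.subset_of_adj K hK F hF y hyK hyF fun t ht hyt => by
      rcases hNK.subset ⟨ht, hyt⟩ with rfl | rfl <;> assumption
    have hK' := h.mem_of_not_and h' huv hK fun hn =>
      hex ⟨K, hK, hyK, hKF, hn.1, hn.2, z, hNK⟩
    exact h'.subset_of_adj K hK' F' hF' x hxK hxF'
      (fun t ht hxt => (hN.subset ⟨hKF ht, hxt⟩).1) hzK

/-- Propagation along paths of simple vertices: faces of the two systems with the same edges at one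
simple vertex are nested if the first stays connected without `u` and `v`. -/
lemma FaceSystem.subset_of_linked (h : FaceSystem G u v 𝓕) (h' : FaceSystem G u v 𝓕')
    (huv : u ≠ v) {F F' : Set V} (hF : F ∈ 𝓕) (hF' : F' ∈ 𝓕') (hu : u ∈ F') (hv : v ∈ F')
    {x : V} (hx : x ∈ F \ {u, v}) (hxF' : x ∈ F')
    (hN : F ∩ G.neighborSet x = F' ∩ G.neighborSet x)
    (hd : G.Adj u v ∨ 3 ≤ (F ∩ G.neighborSet x).ncard) : F ⊆ F' := by
  intro y hy
  by_cases hyuv : y ∈ ({u, v} : Set V)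
  · rcases hyuv with rfl | rfl <;> assumption
  suffices y ∈ F' ∧ F ∩ G.neighborSet y = F' ∩ G.neighborSet y from this.1
  have hlink := h.linked F hF x hx y ⟨hy, hyuv⟩ hd
  clear hyuv hy
  induction hlink with
  | refl => exact ⟨hxF', hN⟩
  | tail _ hbc ih =>
    obtain ⟨⟨hb, hb'⟩, ⟨hc, hc'⟩, hbc⟩ := hbc
    simp only [Set.mem_insert_iff, Set.mem_singleton_iff, not_or] at hb' hc'
    exact h.inter_eq_of_adj h' huv hF hF' hb ih.1 hc hb'.1 hb'.2 hc'.1 hc'.2 hbc ih.2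

/-- Two nonadjacent vertices lie in at most one two-dimensional face. -/
lemma FaceSystem.eq_of_not_adj (h : FaceSystem G u v 𝓕) (huv : u ≠ v) (hadj : ¬ G.Adj u v)
    {F F' : Set V} (hF : F ∈ 𝓕) (hF' : F' ∈ 𝓕) (hu : u ∈ F) (hv : v ∈ F) (hu' : u ∈ F')
    (hv' : v ∈ F') {x y : V} (hx : x ∈ F \ {u, v}) (hy : y ∈ F' \ {u, v})
    (hxd : (F ∩ G.neighborSet x).ncard ≤ 2) (hyd : (F' ∩ G.neighborSet y).ncard ≤ 2) :
    F = F' := by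
  obtain ⟨hxF, hx⟩ := hx
  obtain ⟨hyF, hy⟩ := hy
  simp only [Set.mem_insert_iff, Set.mem_singleton_iff, not_or] at hx hy
  have hI := h.inter F hF F' hF'
  have hex : ∃ z ∈ F ∩ F', z ≠ u ∧ z ≠ v := by
    by_contra! hcon
    refine hadj ((h.adj u v).2 ⟨huv, ?_⟩)
    have : F ∩ F' = {u, v} := Set.Subset.antisymm
      (fun z hz => (em (z = u)).imp_right (hcon z hz))
      (by rintro _ (rfl | rfl); exacts [⟨hu, hu'⟩, ⟨hv, hv'⟩])
    exact this ▸ hI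
  obtain ⟨z, ⟨hz, hz'⟩, hzu, hzv⟩ := hex
  rw [h.ncard_eq F hF x hxF hx.1 hx.2 z hz hzu hzv] at hxd
  rw [h.ncard_eq F' hF' y hyF hy.1 hy.2 z hz' hzu hzv] at hyd
  have h2 : 2 ≤ (F ∩ F' ∩ G.neighborSet z).ncard := by
    by_contra! hlt
    have : Nonempty V := ⟨z⟩
    obtain ⟨t, ht⟩ : ∃ t, F ∩ F' ∩ G.neighborSet z ⊆ {t} :=
      (Set.ncard_le_one_iff_subset_singleton (Set.toFinite _)).1 (Nat.le_of_lt_succ hlt)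
    have hsub : F ∩ F' ⊆ {z, t} := by
      by_cases htz : t ∈ F ∩ F' ∩ G.neighborSet z
      · exact h.subset_of_adj _ hI _ ((h.adj z t).1 htz.2).2 z ⟨hz, hz'⟩ (Or.inl rfl)
          fun s hs hzs => Or.inr (ht ⟨hs, hzs⟩)
      · refine (h.subset_of_adj _ hI {z} (h.singleton z) z ⟨hz, hz'⟩ rfl
          fun s hs hzs => ?_).trans (by simp)
        obtain rfl : s = t := ht ⟨hs, hzs⟩
        exact absurd ⟨hs, hzs⟩ htz
    have hut : u = t := (hsub ⟨hu, hu'⟩).resolve_left hzu.symm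
    have hvt : v = t := (hsub ⟨hv, hv'⟩).resolve_left hzv.symm
    exact huv (hut.trans hvt.symm)
  have e1 : F ∩ F' ∩ G.neighborSet z = F ∩ G.neighborSet z :=
    Set.eq_of_subset_of_ncard_le (Set.inter_subset_inter_left _ Set.inter_subset_left)
      (hxd.trans h2) (Set.toFinite _)
  have e2 : F ∩ F' ∩ G.neighborSet z = F' ∩ G.neighborSet z :=
    Set.eq_of_subset_of_ncard_le (Set.inter_subset_inter_left _ Set.inter_subset_right)
      (hyd.trans h2) (Set.toFinite _)
  exact h.eq_of_inter_eq hF hF' hz hz' (e1.symm.trans e2)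

/-- A face spanned at a simple vertex of `F` by the edges of `F`, but in the other face system,
contains both exceptional vertices if `F` does. -/
lemma FaceSystem.exists_spanned (h : FaceSystem G u v 𝓕) (h' : FaceSystem G u v 𝓕') (huv : u ≠ v)
    {F : Set V} (hF : F ∈ 𝓕) (hu : u ∈ F) (hv : v ∈ F) {x : V} (hx : x ∈ F \ {u, v}) :
    ∃ F' ∈ 𝓕', u ∈ F' ∧ v ∈ F' ∧ x ∈ F' ∧ F ∩ G.neighborSet x = F' ∩ G.neighborSet x := by
  obtain ⟨hxF, hx⟩ := hx
  simp only [Set.mem_insert_iff, Set.mem_singleton_iff, not_or] at hx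
  obtain ⟨F', hF', hxF', hN⟩ := h'.exists_face x hx.1 hx.2 (F ∩ G.neighborSet x)
    Set.inter_subset_right
  suffices u ∈ F' ∧ v ∈ F' from ⟨F', hF', this.1, this.2, hxF', hN.symm⟩
  by_contra hn
  have := h.eq_of_inter_eq hF (h'.mem_of_not_and h huv hF' hn) hxF hxF' hN.symm
  exact hn ⟨this ▸ hu, this ▸ hv⟩

/-- The graph determines the face system. -/
theorem FaceSystem.subset (h : FaceSystem G u v 𝓕) (h' : FaceSystem G u v 𝓕') (huv : u ≠ v) :
    𝓕 ⊆ 𝓕' := by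
  intro F hF
  by_cases hn : u ∈ F ∧ v ∈ F
  swap
  · exact h.mem_of_not_and h' huv hF hn
  obtain ⟨hu, hv⟩ := hn
  by_cases hex : ∃ x, x ∈ F \ {u, v}
  swap
  · have hFuv : F = {u, v} := Set.Subset.antisymm
      (fun x hx => by_contra fun hx' => hex ⟨x, hx, hx'⟩)
      (by rintro _ (rfl | rfl) <;> assumption)
    rw [hFuv] at hF ⊢
    exact ((h'.adj u v).1 ((h.adj u v).2 ⟨huv, hF⟩)).2
  obtain ⟨x, hx⟩ := hex
  obtain ⟨F', hF', hu', hv', hxF', hN⟩ := h.exists_spanned h' huv hF hu hv hx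
  suffices F = F' from this ▸ hF'
  by_cases hd : G.Adj u v ∨ 3 ≤ (F ∩ G.neighborSet x).ncard
  · exact (h.subset_of_linked h' huv hF hF' hu' hv' hx hxF' hN hd).antisymm
      (h'.subset_of_linked h huv hF' hF hu hv ⟨hxF', hx.2⟩ hx.1 hN.symm (hN ▸ hd))
  · push Not at hd
    have hd2 : (F ∩ G.neighborSet x).ncard ≤ 2 := by omega
    -- here `u` and `v` are not adjacent and all faces involved are two-dimensional, so the faces
    -- spanned in `𝓑` at the simple vertices of `A` coincide
    have key : ∀ {𝓐 𝓑 : Set (Set V)}, FaceSystem G u v 𝓐 → FaceSystem G u v 𝓑 →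
        ∀ {A B : Set V}, A ∈ 𝓐 → B ∈ 𝓑 → u ∈ A → v ∈ A → u ∈ B → v ∈ B → x ∈ A → x ∈ B →
        (A ∩ G.neighborSet x).ncard ≤ 2 → (B ∩ G.neighborSet x).ncard ≤ 2 → A ⊆ B := by
      intro 𝓐 𝓑 hA hB A B hAm hBm huA hvA huB hvB hxA hxB hcA hcB y hy
      by_cases hyuv : y ∈ ({u, v} : Set V)
      · rcases hyuv with rfl | rfl <;> assumption
      obtain ⟨C, hC, huC, hvC, hyC, hNC⟩ := hA.exists_spanned hB huv hAm huA hvA ⟨hy, hyuv⟩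
      have hyuv' := hyuv
      have hxuv' := hx.2
      simp only [Set.mem_insert_iff, Set.mem_singleton_iff, not_or] at hyuv' hxuv'
      have hcC : (C ∩ G.neighborSet y).ncard ≤ 2 := by
        rw [← hNC, hA.ncard_eq A hAm y hy hyuv'.1 hyuv'.2 x hxA hxuv'.1 hxuv'.2]
        exact hcA
      rw [hB.eq_of_not_adj huv hd.1 hBm hC huB hvB huC hvC ⟨hxB, hx.2⟩ ⟨hyC, hyuv⟩ hcB hcC]
      exact hyC
    exact (key h h' hF hF' hu hv hu' hv' hx.1 hxF' hd2 (hN ▸ hd2)).antisymm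
      (key h' h hF' hF hu' hv' hu hv hxF' hx.1 (hN ▸ hd2) hd2)

end FaceSystems

/-! ### Polytopes and their affine functions -/

section AffineFunctions

variable {V E : Type*} [NormedAddCommGroup E] [NormedSpace ℝ E]

/-- The map that sends a linear functional `φ` and a constant `c` to the values of `φ + c` at the
points of the family `p`. -/
def affineEval (p : V → E) : (Module.Dual ℝ E × ℝ) →ₗ[ℝ] (V → ℝ) where
  toFun a v := a.1 (p v) + a.2
  map_add' a b := funext fun v => add_add_add_comm (a.1 (p v)) (b.1 (p v)) a.2 b.2
  map_smul' c a := by ext v; simp [mul_add]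

/-- The space of restrictions of affine functions to the points of a family. -/
def affineFunctions (p : V → E) : Submodule ℝ (V → ℝ) := LinearMap.range (affineEval p)

lemma mem_affineFunctions {p : V → E} {l : V → ℝ} :
    l ∈ affineFunctions p ↔ ∃ (φ : Module.Dual ℝ E) (c : ℝ), ∀ v, l v = φ (p v) + c := by
  refine ⟨?_, ?_⟩
  · rintro ⟨a, rfl⟩
    exact ⟨a.1, a.2, fun v => rfl⟩
  · rintro ⟨φ, c, h⟩
    exact ⟨(φ, c), funext fun v => (h v).symm⟩

variable {p : V → E} {P F F' : Set E}

lemma isFace_of_isExposed (hP : P = convexHull ℝ (Set.range p)) (hF : IsExposed ℝ P F) :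
    IsFace (affineFunctions p) {v | p v ∈ F} := by
  have hpP : ∀ v, p v ∈ P := fun v => hP ▸ subset_convexHull ℝ _ ⟨v, rfl⟩
  rcases F.eq_empty_or_nonempty with rfl | hne
  · exact ⟨fun _ => 1, mem_affineFunctions.2 ⟨0, 1, by simp⟩, by simp, by simp⟩
  obtain ⟨l, rfl⟩ := hF hne
  obtain ⟨x, hxP, hx⟩ := hne
  refine ⟨fun v => l x - l (p v), mem_affineFunctions.2 ⟨-l.toLinearMap, l x, fun v => ?_⟩,
    fun v => sub_nonneg.2 (hx _ (hpP v)), fun v => ⟨fun h => ⟨hpP v, fun y hy => ?_⟩, fun h => ?_⟩⟩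
  · simp only [LinearMap.neg_apply, ContinuousLinearMap.coe_coe]; ring
  · rw [← sub_eq_zero.1 h]; exact hx y hy
  · exact le_antisymm (sub_nonpos.2 (h.2 x hxP)) (sub_nonneg.2 (hx _ (hpP v)))

lemma exists_isExposed_of_isFace [FiniteDimensional ℝ E] (hP : P = convexHull ℝ (Set.range p))
    {S : Set V} (hS : IsFace (affineFunctions p) S) :
    ∃ F, IsExposed ℝ P F ∧ ∀ v, p v ∈ F ↔ v ∈ S := by
  have hpP : ∀ v, p v ∈ P := fun v => hP ▸ subset_convexHull ℝ _ ⟨v, rfl⟩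
  rcases S.eq_empty_or_nonempty with rfl | ⟨s, hs⟩
  · exact ⟨∅, isExposed_empty, by simp⟩
  obtain ⟨l, hl, l0, l1⟩ := hS
  obtain ⟨φ, c, hφ⟩ := mem_affineFunctions.1 hl
  have hnn : ∀ y ∈ P, -c ≤ φ y := by
    intro y hy
    rw [hP] at hy
    refine convexHull_min (t := {y | -c ≤ φ y}) ?_ (convex_halfSpace_ge φ.isLinear _) hy
    rintro _ ⟨v, rfl⟩
    have := l0 v
    rw [hφ] at this
    exact neg_le_iff_add_nonneg.2 this
  have hsc : φ (p s) = -c := by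
    have := (l1 s).2 hs
    rw [hφ] at this
    exact eq_neg_of_add_eq_zero_left this
  refine ⟨(-LinearMap.toContinuousLinearMap φ).toExposed P,
    ContinuousLinearMap.toExposed.isExposed, fun v => ?_⟩
  rw [← l1 v, hφ]
  constructor
  · rintro ⟨-, h⟩
    have := h _ (hpP s)
    simp only [neg_apply, LinearMap.coe_toContinuousLinearMap', hsc] at this
    linarith [hnn _ (hpP v)]
  · intro h
    refine ⟨hpP v, fun y hy => ?_⟩
    simp only [neg_apply, LinearMap.coe_toContinuousLinearMap']
    linarith [hnn y hy]

/-- An exposed face of a polytope lies in each closed convex set that contains its vertices. -/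
lemma IsExposed.subset_of_vertices [Finite V] (hP : P = convexHull ℝ (Set.range p))
    (hF : IsExposed ℝ P F) {C : Set E} (hC : Convex ℝ C) (hCc : IsClosed C)
    (h : ∀ v, p v ∈ F → p v ∈ C) : F ⊆ C := by
  have hPc : IsCompact P := hP ▸ (Set.finite_range p).isCompact_convexHull ℝ
  have hPconv : Convex ℝ P := hP ▸ convex_convexHull ℝ _
  rw [← closure_convexHull_extremePoints (hF.isCompact hPc) (hF.convex hPconv)]
  refine closure_minimal (convexHull_min ?_ hC) hCc
  intro x hx
  have hx' := hF.isExtreme.extremePoints_subset_extremePoints hx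
  rw [hP] at hx'
  obtain ⟨v, rfl⟩ := extremePoints_convexHull_subset hx'
  exact h v (extremePoints_subset hx)

lemma IsExposed.subset_of_forall_mem [Finite V] (hP : P = convexHull ℝ (Set.range p))
    (hF : IsExposed ℝ P F) (hF' : IsExposed ℝ P F') (h : ∀ v, p v ∈ F → p v ∈ F') : F ⊆ F' := by
  have hPc : IsCompact P := hP ▸ (Set.finite_range p).isCompact_convexHull ℝ
  have hPconv : Convex ℝ P := hP ▸ convex_convexHull ℝ _
  exact hF.subset_of_vertices hP (hF'.convex hPconv) (hF'.isCompact hPc).isClosed h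

lemma isFace_pair_iff [Finite V] [FiniteDimensional ℝ E] (hP : P = convexHull ℝ (Set.range p))
    (hp : Function.Injective p) (hv : ∀ v, IsExposed ℝ P {p v}) (x y : V) :
    IsFace (affineFunctions p) {x, y} ↔ IsExposed ℝ P (segment ℝ (p x) (p y)) := by
  have hpP : ∀ v, p v ∈ P := fun v => hP ▸ subset_convexHull ℝ _ ⟨v, rfl⟩
  have hPconv : Convex ℝ P := hP ▸ convex_convexHull ℝ _
  constructor
  · intro h
    obtain ⟨F, hF, hFv⟩ := exists_isExposed_of_isFace hP h
    suffices F = segment ℝ (p x) (p y) from this ▸ hF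
    refine Set.Subset.antisymm (hF.subset_of_vertices hP (convex_segment _ _) ?_ ?_) ?_
    · rw [← convexHull_pair]
      exact ((Set.toFinite {p x, p y}).isCompact_convexHull ℝ).isClosed
    · intro v hv
      rcases (hFv v).1 hv with rfl | rfl
      exacts [left_mem_segment ℝ _ _, right_mem_segment ℝ _ _]
    · exact (hF.convex hPconv).segment_subset ((hFv x).2 (by simp)) ((hFv y).2 (by simp))
  · intro h
    have hF := isFace_of_isExposed hP h
    suffices {v | p v ∈ segment ℝ (p x) (p y)} = {x, y} from this ▸ hF
    ext v
    constructor
    · intro hseg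
      have hext : p v ∈ P.extremePoints ℝ := (hv v).isExtreme.mem_extremePoints
      rcases (mem_extremePoints_iff_forall_segment.1 hext).2 _ (hpP x) _ (hpP y) hseg with h | h
      · exact Or.inl (hp h.symm)
      · exact Or.inr (hp h.symm)
    · rintro (rfl | rfl)
      exacts [left_mem_segment ℝ _ _, right_mem_segment ℝ _ _]

/-- The affine functions that vanish on the polytope are determined by their linear parts, which
annihilate its direction. -/
lemma finrank_vectorSpan_add_one_le [Finite V] [Nonempty V] [FiniteDimensional ℝ E]
    (hP : P = convexHull ℝ (Set.range p)) :
    Module.finrank ℝ (vectorSpan ℝ P) + 1 ≤ Module.finrank ℝ (affineFunctions p) := by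
  have h1 := LinearMap.finrank_range_add_finrank_ker (affineEval p)
  have h2 := Subspace.finrank_add_finrank_dualAnnihilator_eq (vectorSpan ℝ P)
  rw [Module.finrank_prod, Subspace.dual_finrank_eq, Module.finrank_self] at h1
  have hconst : ∀ a ∈ LinearMap.ker (affineEval p), ∀ v, a.1 (p v) = -a.2 := fun a ha v =>
    eq_neg_of_add_eq_zero_left (congrFun (LinearMap.mem_ker.1 ha) v)
  have hmem : ∀ a : LinearMap.ker (affineEval p),
      ((LinearMap.fst ℝ _ _).comp (LinearMap.ker (affineEval p)).subtype) a ∈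
        (vectorSpan ℝ P).dualAnnihilator := by
    rintro ⟨a, ha⟩
    have hP' : ∀ x ∈ P, a.1 x = -a.2 := by
      intro x hx
      rw [hP] at hx
      refine convexHull_min (t := {y | a.1 y = -a.2}) ?_ (convex_hyperplane a.1.isLinear _) hx
      rintro _ ⟨v, rfl⟩
      exact hconst a ha v
    have hle : vectorSpan ℝ P ≤ LinearMap.ker a.1 := by
      rw [vectorSpan_def, Submodule.span_le]
      rintro _ ⟨x, hx, y, hy, rfl⟩
      simp [hP' x hx, hP' y hy]
    exact (Submodule.mem_dualAnnihilator _).2 fun w hw => hle hw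
  have h3 := LinearMap.finrank_le_finrank_of_injective (f := LinearMap.codRestrict _ _ hmem) (by
    rintro ⟨a, ha⟩ ⟨b, hb⟩ hab
    have hab1 : a.1 = b.1 := congrArg Subtype.val hab
    obtain ⟨v⟩ := ‹Nonempty V›
    have hab2 : a.2 = b.2 := neg_injective (by rw [← hconst a ha v, ← hconst b hb v, hab1])
    exact Subtype.ext (Prod.ext hab1 hab2))
  unfold affineFunctions
  omega

/-- A point of a finite set that is extreme in the convex hull of the set is exposed in it. -/
lemma isExposed_singleton_of_mem_extremePoints {S : Set E} (hS : S.Finite) {x : E}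
    (hx : x ∈ (convexHull ℝ S).extremePoints ℝ) : IsExposed ℝ (convexHull ℝ S) {x} := by
  have hxS := extremePoints_convexHull_subset hx
  rw [(convex_convexHull ℝ S).mem_extremePoints_iff_mem_sdiff_convexHull_sdiff] at hx
  have hx' : x ∉ convexHull ℝ (S \ {x}) := fun h =>
    hx.2 (convexHull_mono (Set.sdiff_subset_sdiff_left (subset_convexHull ℝ S)) h)
  obtain ⟨f, c, hfx, hf⟩ := geometric_hahn_banach_point_closed (convex_convexHull ℝ _)
    (hS.sdiff.isCompact_convexHull ℝ).isClosed hx'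
  -- an open half-space stays convex when a boundary point is added
  have hmin : convexHull ℝ S ⊆ {y | y = x ∨ f x < f y} := by
    refine convexHull_min (fun s hs => ?_) ?_
    · by_cases hsx : s = x
      · exact Or.inl hsx
      · exact Or.inr (hfx.trans (hf s (subset_convexHull ℝ _ ⟨hs, hsx⟩)))
    · rw [convex_iff_forall_pos]
      rintro y hy z hz a b ha hb hab
      by_cases hyz : y = x ∧ z = x
      · left
        rw [hyz.1, hyz.2, ← add_smul, hab, one_smul]
      · right
        have hxab : f x = a * f x + b * f x := by rw [← add_mul, hab, one_mul]
        rw [map_add, map_smul, map_smul, smul_eq_mul, smul_eq_mul, hxab]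
        rcases hy with rfl | hy
        · have hz := hz.resolve_left fun h => hyz ⟨rfl, h⟩
          linarith [mul_lt_mul_of_pos_left hz hb]
        · have h2 : f x ≤ f z := by rcases hz with rfl | hz; exacts [le_rfl, hz.le]
          linarith [mul_lt_mul_of_pos_left hy ha, mul_le_mul_of_nonneg_left h2 hb.le]
  intro _
  refine ⟨-f, Set.Subset.antisymm ?_ ?_⟩
  · rintro _ rfl
    refine ⟨hx.1, fun y hy => ?_⟩
    rcases hmin hy with rfl | h
    · exact le_rfl
    · simpa using h.le
  · rintro y ⟨hy, hmax⟩
    refine (hmin hy).resolve_right fun h => ?_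
    have := hmax x hx.1
    simp only [neg_apply, neg_le_neg_iff] at this
    exact this.not_gt h

end AffineFunctions

/-! ### Vertices of polytopes and the face lattice -/

section Polytopes

variable {n d : ℕ} {P : Set (EuclideanSpace ℝ (Fin n))}

lemma IsDPolytope.finite_vertices (hP : IsDPolytope d P) : Finite (PolytopeVertex P) := by
  obtain ⟨-, ⟨S, rfl⟩, -⟩ := hP
  exact (S.finite_toSet.subset fun x hx =>
    extremePoints_convexHull_subset (IsExposed.isExtreme hx).mem_extremePoints).to_subtype

lemma IsDPolytope.eq_convexHull_vertices (hP : IsDPolytope d P) :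
    P = convexHull ℝ (Set.range (Subtype.val : PolytopeVertex P → EuclideanSpace ℝ (Fin n))) := by
  have hfin := hP.finite_vertices
  obtain ⟨-, ⟨S, hS⟩, -⟩ := hP
  have hPc : IsCompact P := hS ▸ S.finite_toSet.isCompact_convexHull ℝ
  have hPconv : Convex ℝ P := hS ▸ convex_convexHull ℝ _
  refine Set.Subset.antisymm ?_ (convexHull_min ?_ hPconv)
  · conv_lhs => rw [← closure_convexHull_extremePoints hPc hPconv]
    refine closure_minimal (convexHull_mono fun x hx => ?_)
      ((Set.finite_range _).isCompact_convexHull ℝ).isClosed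
    subst hS
    exact ⟨⟨x, isExposed_singleton_of_mem_extremePoints S.finite_toSet hx⟩, rfl⟩
  · rintro _ ⟨v, rfl⟩
    exact v.2.subset rfl

variable {V : Type*} {G : SimpleGraph V}

lemma IsDPolytope.eq_convexHull_range (hP : IsDPolytope d P) (e : V ≃ PolytopeVertex P) :
    P = convexHull ℝ (Set.range fun v => (e v).1) := by
  have : Set.range (fun v => (e v).1) = Set.range (Subtype.val : PolytopeVertex P → _) :=
    e.surjective.range_comp Subtype.val
  rw [this]
  exact hP.eq_convexHull_vertices

/-- The affine functions on the vertices of a polytope, where the vertices may be labelled by any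
type. -/
lemma IsDPolytope.isPolytopal (hP : IsDPolytope d P) (e : G ≃g polytopeGraph P) :
    IsPolytopal d G (affineFunctions fun v => (e v).1) := by
  have hfinP := hP.finite_vertices
  have hfin : Finite V := Finite.of_equiv _ e.symm.toEquiv
  have hPe : P = convexHull ℝ (Set.range fun v => (e v).1) := hP.eq_convexHull_range e.toEquiv
  have hinj : Function.Injective fun v => (e v).1 := Subtype.val_injective.comp e.injective
  refine ⟨?_, fun v => ?_, fun x y => ?_, ?_⟩
  · simpa using isFace_of_isExposed hPe isExposed_empty
  · have := isFace_of_isExposed hPe (e v).2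
    simpa only [Set.mem_singleton_iff, Subtype.val_inj,
      EmbeddingLike.apply_eq_iff_eq, Set.ofPred_eq_eq_singleton] using this
  · rw [isFace_pair_iff hPe hinj (fun v => (e v).2), ← e.map_adj_iff]
    exact and_congr_left' e.injective.ne_iff
  · have : Nonempty V := by
      by_contra hV
      rw [not_nonempty_iff] at hV
      have := hP.1
      rw [hPe, Set.range_eq_empty, convexHull_empty] at this
      exact Set.not_nonempty_empty this
    have := finrank_vectorSpan_add_one_le hPe
    rwa [hP.2.2] at this

end Polytopes

theorem mainTheorem4 (d n m : ℕ)
    (P : Set (EuclideanSpace ℝ (Fin n))) (hP : IsDPolytope d P)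
    (hns : (nonsimpleVertices d P).encard ≤ 2)
    (Q : Set (EuclideanSpace ℝ (Fin m))) (hQ : IsDPolytope d Q)
    (f : polytopeGraph P ≃g polytopeGraph Q) :
    ∃ Φ : FaceLattice P ≃o FaceLattice Q,
      ∀ (F : FaceLattice P) (v : PolytopeVertex P), v.1 ∈ F.1 ↔ (f v).1 ∈ (Φ F).1 := by
  have hfin := hP.finite_vertices
  have hLP := hP.isPolytopal (SimpleGraph.Iso.refl (G := polytopeGraph P))
  have hLQ := hQ.isPolytopal f
  have hPe := hP.eq_convexHull_range (Equiv.refl _)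
  have hQe := hQ.eq_convexHull_range f.toEquiv
  -- both polytopes have the same vertex sets of faces
  have hfaces : ∀ S, IsFace (affineFunctions fun v : PolytopeVertex P => v.1) S ↔
      IsFace (affineFunctions fun v => (f v).1) S := by
    rcases subsingleton_or_nontrivial (PolytopeVertex P) with hsub | hnt
    · intro S
      rcases S.eq_empty_or_nonempty with rfl | ⟨s, hs⟩
      · exact iff_of_true hLP.pos hLQ.pos
      · obtain rfl : S = Set.univ := Set.eq_univ_of_forall fun x => Subsingleton.elim s x ▸ hs
        exact iff_of_true isFace_univ isFace_univ
    · obtain ⟨N, hN, -, hN2⟩ := Set.exists_superset_subset_encard_eq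
        (Set.subset_univ (nonsimpleVertices d P)) hns
        (by rw [Set.encard_univ, ENat.card_eq_coe_natCard]
            exact_mod_cast (Finite.one_lt_card : 1 < Nat.card (PolytopeVertex P)))
      obtain ⟨u, v, huv, rfl⟩ := Set.encard_eq_two.1 hN2
      have hs : ∀ w, w ≠ u → w ≠ v → ((polytopeGraph P).neighborSet w).ncard ≤ d := by
        intro w hwu hwv
        have hw : w ∉ nonsimpleVertices d P := fun h => by
          rcases hN h with h | h
          exacts [hwu h, hwv h]
        have hw : ((polytopeGraph P).neighborSet w).encard ≤ d := not_lt.1 hw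
        rw [← (Set.toFinite _).cast_ncard_eq] at hw
        exact_mod_cast hw
      have h1 := hLP.faceSystem hs
      have h2 := hLQ.faceSystem hs
      exact fun S => ⟨fun h => h1.subset h2 huv h, fun h => h2.subset h1 huv h⟩
  have hmap : ∀ F : FaceLattice P, ∃ F' : FaceLattice Q, ∀ v, v.1 ∈ F.1 ↔ (f v).1 ∈ F'.1 := by
    intro F
    obtain ⟨F', hF', h⟩ := exists_isExposed_of_isFace hQe
      ((hfaces _).1 (isFace_of_isExposed hPe F.2))
    exact ⟨⟨F', hF'⟩, fun v => (h v).symm⟩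
  choose φ hφ using hmap
  have hle : ∀ F F' : FaceLattice P, φ F ≤ φ F' ↔ F ≤ F' := fun F F' =>
    ⟨fun h => F.2.subset_of_forall_mem hPe F'.2 fun v hv => (hφ F' v).2 (h ((hφ F v).1 hv)),
      fun h => (φ F).2.subset_of_forall_mem hQe (φ F').2 fun v hv =>
        (hφ F' v).1 (h ((hφ F v).2 hv))⟩
  have hsurj : Function.Surjective φ := by
    intro F'
    obtain ⟨F, hF, h⟩ := exists_isExposed_of_isFace hPe
      ((hfaces _).2 (isFace_of_isExposed hQe F'.2))
    have hv : ∀ v, (f v).1 ∈ (φ ⟨F, hF⟩).1 ↔ (f v).1 ∈ F'.1 := fun v =>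
      (hφ ⟨F, hF⟩ v).symm.trans (h v)
    exact ⟨⟨F, hF⟩, Subtype.ext (Set.Subset.antisymm
      ((φ _).2.subset_of_forall_mem hQe F'.2 fun v => (hv v).1)
      (F'.2.subset_of_forall_mem hQe (φ _).2 fun v => (hv v).2))⟩
  exact ⟨OrderIso.ofSurjective (OrderEmbedding.ofMapLEIff φ hle) hsurj, hφ⟩
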